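/- Let $D$ be finite, let $A,B$ be complex $D\times D$ matrices with $A=A^\dagger$, $B=B^T$, and put \[ S=\begin{pmatrix}A&B\\B^*&A^*\end{pmatrix},\quad N=\begin{pmatrix}1&0\\0&-1\end{pmatrix},\quad \Sigma_x=\begin{pmatrix}0&1\\1&0\end{pmatrix}, \] where $M^*$ denotes the entrywise complex conjugate. Let $\{\xi^{(\nu)}_k : 1\le k\le d_\nu\}$, with $\nu$ running over a finite index set and $d_\nu\ge1$, be a basis of $\mathbb C^{2D}$ consisting of Jordan chains of $NS$: \[ S\xi^{(\nu)}_1=\omega_\nu N\xi^{(\nu)}_1,\qquad S\xi^{(\nu)}_{k+1}=\omega_\nu N\xi^{(\nu)}_{k+1}+ic^{(\nu)}_kN\xi^{(\nu)}_k\quad(1\le k<d_\nu,\ c^{(\nu)}_k\neq0). \] Let $\bar\xi^{(\nu)}_k$ be LR-dual vectors, i.e. $\bar\xi^{(\nu)\dagger}_kN\xi^{(\nu')}_{k'}\neq0$ if and only if $(\nu,k)=(\nu',k')$. Put $W_\nu=\mathrm{span}_k\,\xi^{(\nu)}_k$, $\bar W_\nu=\mathrm{span}_k\,\bar\xi^{(\nu)}_k$,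 $\Sigma_xW_\nu^*=\mathrm{span}_k\,\Sigma_x\xi^{(\nu)*}_k$, $\Sigma_x\bar W_\nu^*=\mathrm{span}_k\,\Sigma_x\bar\xi^{(\nu)*}_k$, and suppose that the system of blocks is closed under both dualities: for every $\nu$, each of $\bar W_\nu$ and $\Sigma_xW^*_\nu$ is again one of the subspaces $W_{\nu'}$. Let \[ \Lambda_\nu=\sum_{k=1}^{d_\nu}\frac{\xi^{(\nu)}_k\,\bar\xi^{(\nu)\dagger}_kN}{\bar\xi^{(\nu)\dagger}_kN\xi^{(\nu)}_k}, \] let the collective index $[\nu]$ be the set of those $\nu'$ for which $W_{\nu'}$ is one of $W_\nu,\bar W_\nu,\Sigma_xW_\nu^*,\Sigma_x\bar W_\nu^*$, and put $\Lambda_{[\nu]}=\sum_{\nu'\in[\nu]}\Lambda_{\nu'}$, $W_{[\nu]}=W_\nu+\bar W_\nu+\Sigma_xW_\nu^*+\Sigma_x\bar W_\nu^*$, and $M_{[\nu]}=\Lambda_{[\nu]}^\dagger M\Lambda_{[\nu]}$ for a $2D\times2D$ matrix $M$. Then, for all $\nu,\nu'$: 1. $\Lambda_{[\nu]}^\dagger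 S\Lambda_{[\nu']}=\delta_{[\nu],[\nu']}S_{[\nu]}$ and $\Lambda_{[\nu]}^\dagger N\Lambda_{[\nu']}=\delta_{[\nu],[\nu']}N_{[\nu]}$. 2. The RPA equation decomposes block by block: $\Lambda_{[\nu]}\Lambda_{[\nu']}=\delta_{[\nu],[\nu']}\Lambda_{[\nu]}$, the range of $\Lambda_{[\nu]}$ is $W_{[\nu]}$, and, summing over the distinct collective indices, $\sum_{[\nu]}\Lambda_{[\nu]}=1$, $S=\sum_{[\nu]}S_{[\nu]}$, $N=\sum_{[\nu]}N_{[\nu]}$. For $\omega\in\mathbb C$ and $x\in W_{[\nu]}$, $Sx=\omega Nx$ if and only if $S_{[\nu]}x=\omega N_{[\nu]}x$. For $\omega\in\mathbb C$ and $x\in\mathbb C^{2D}$, $Sx=\omega Nx$ if and only if $S_{[\nu]}\Lambda_{[\nu]}x=\omega N_{[\nu]}\Lambda_{[\nu]}x$ for every $[\nu]$. 3. $S_{[\nu]}=S_{[\nu]}^\dagger$ and $\Sigma_xS_{[\nu]}^*\Sigma_x=S_{[\nu]}$. -/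

import Mathlib

open scoped Matrix

noncomputable section

namespace RPA

variable {α : Type*} [Fintype α] [DecidableEq α]

/-- The space `ℂ^{2D}` of vectors `(X, Y)`, where `D` is the cardinality of `α`. -/
abbrev Vec (α : Type*) : Type _ := α ⊕ α → ℂ

/-- Square matrices of size `2D`. -/
abbrev Mat (α : Type*) : Type _ := Matrix (α ⊕ α) (α ⊕ α) ℂ

/-- The entrywise complex conjugate `M^*` of a matrix. -/
def conjMat (M : Mat α) : Mat α := M.map star

/-- The stability matrix `S = [[A, B], [B^*, A^*]]`. -/
def stab (A B : Matrix α α ℂ) : Mat α :=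
  Matrix.fromBlocks A B (B.map star) (A.map star)

/-- The metric matrix `N = diag(1, -1)`. -/
def metricN (α : Type*) [DecidableEq α] : Mat α := Matrix.fromBlocks 1 0 0 (-1)

/-- The matrix `Σ_x = [[0, 1], [1, 0]]`. -/
def sigmaX (α : Type*) [DecidableEq α] : Mat α := Matrix.fromBlocks 0 1 1 0

/-- The sesquilinear pairing `x† N y`. -/
def pairing (x y : Vec α) : ℂ := star x ⬝ᵥ (metricN α *ᵥ y)

/-- The UL-dual `Σ_x x^*` of a vector `x`. -/
def ulDual (x : Vec α) : Vec α := sigmaX α *ᵥ star x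

/-- A complete system of Jordan blocks of `N S`, indexed by `ι`.  The block `ν` has dimension
`d ν ≥ 1` and eigenvalue `ω ν`, its basis vectors `ξ ν k` (here `k = 0, …, d ν - 1`) satisfy
`S ξ_{k+1} = ω N ξ_{k+1} + i c_k N ξ_k` with `c_k ≠ 0`, the first being an eigenvector, and all
the basis vectors together form a basis of the whole space.  (As they do, no chain can be
prolonged within a larger block.) -/
structure JordanSystem (A B : Matrix α α ℂ) (ι : Type*) where
  d : ι → ℕ
  d_pos : ∀ ν, 0 < d ν
  ω : ι → ℂ
  c : ι → ℕ → ℂ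
  c_ne : ∀ ν k, k + 1 < d ν → c ν k ≠ 0
  ξ : (ν : ι) → Fin (d ν) → Vec α
  eigen : ∀ ν, stab A B *ᵥ ξ ν ⟨0, d_pos ν⟩ = ω ν • (metricN α *ᵥ ξ ν ⟨0, d_pos ν⟩)
  chain : ∀ ν k, ∀ hk : k + 1 < d ν,
    stab A B *ᵥ ξ ν ⟨k + 1, hk⟩ =
      ω ν • (metricN α *ᵥ ξ ν ⟨k + 1, hk⟩)
        + (Complex.I * c ν k) • (metricN α *ᵥ ξ ν ⟨k, Nat.lt_of_succ_lt hk⟩)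
  indep : LinearIndependent ℂ (fun p : (ν : ι) × Fin (d ν) => ξ p.1 p.2)
  complete : Submodule.span ℂ (Set.range fun p : (ν : ι) × Fin (d ν) => ξ p.1 p.2) = ⊤

/-- The subspace `W_ν` spanned by the block `ν`. -/
def JordanSystem.W {A B : Matrix α α ℂ} {ι : Type*} (J : JordanSystem A B ι) (ν : ι) :
    Submodule ℂ (Vec α) :=
  Submodule.span ℂ (Set.range (J.ξ ν))

/-- A complete system of Jordan blocks of `N S` adapted to both dualities.
* Every basis vector `ξ ν k` has an LR-dual vector `ξbar ν k`, whose pairing with a basis vector is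
  nonzero for `ξ ν k` and for no other one; no normalization of it is imposed.
* The LR-dual vectors of a block span a block of the system again, and so do its UL-dual vectors;
  these blocks may coincide with each other or with the given one. -/
structure DualJordanSystem (A B : Matrix α α ℂ) (ι : Type*) extends JordanSystem A B ι where
  ξbar : (ν : ι) → Fin (d ν) → Vec α
  dual : ∀ p q : (ν : ι) × Fin (d ν), pairing (ξbar p.1 p.2) (ξ q.1 q.2) ≠ 0 ↔ p = q
  lr_closed : ∀ ν, ∃ ν',
    Submodule.span ℂ (Set.range (ξbar ν)) = toJordanSystem.W ν'
  ul_closed : ∀ ν, ∃ ν',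
    Submodule.span ℂ (Set.range fun k => ulDual (ξ ν k)) = toJordanSystem.W ν'

namespace DualJordanSystem

variable {A B : Matrix α α ℂ} {ι : Type*} (J : DualJordanSystem A B ι)

/-- The LR-dual subspace of `W_ν`. -/
def Wbar (ν : ι) : Submodule ℂ (Vec α) := Submodule.span ℂ (Set.range (J.ξbar ν))

/-- The UL-dual subspace `Σ_x W_ν^*`. -/
def WUL (ν : ι) : Submodule ℂ (Vec α) :=
  Submodule.span ℂ (Set.range fun k => ulDual (J.ξ ν k))

/-- The UL-dual of the LR-dual subspace. -/
def WbarUL (ν : ι) : Submodule ℂ (Vec α) :=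
  Submodule.span ℂ (Set.range fun k => ulDual (J.ξbar ν k))

/-- The projector `Λ_{ν,k} = ξ ξbar† N / (ξbar† N ξ)`. -/
def projVec (ν : ι) (k : Fin (J.d ν)) : Mat α :=
  (pairing (J.ξbar ν k) (J.ξ ν k))⁻¹ •
    Matrix.vecMulVec (J.ξ ν k) (star (J.ξbar ν k) ᵥ* metricN α)

/-- The projector `Λ_ν = ∑_k Λ_{ν,k}`. -/
def projBlock (ν : ι) : Mat α := ∑ k, J.projVec ν k

/-- The subspace `W_[ν]`, the sum of `W_ν`, of its LR- and UL-dual, and of the UL-dual of the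
LR-dual. -/
def Wcoll (ν : ι) : Submodule ℂ (Vec α) := J.W ν ⊔ J.Wbar ν ⊔ J.WUL ν ⊔ J.WbarUL ν

variable [Fintype ι]

open Classical in
/-- The collective index `[ν]`: the set of those blocks whose subspace is one of the four
subspaces that the dualities produce from `ν`. -/
def coll (ν : ι) : Finset ι :=
  Finset.univ.filter fun ν' =>
    J.W ν' = J.W ν ∨ J.W ν' = J.Wbar ν ∨ J.W ν' = J.WUL ν ∨ J.W ν' = J.WbarUL ν

open Classical in
/-- The finite set of all collective indices. -/
def colls : Finset (Finset ι) := Finset.univ.image J.coll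

/-- The projector `Λ_C = ∑_{ν ∈ C} Λ_ν` for a set `C` of blocks; `Λ_[ν]` is the case
`C = [ν]`. -/
def projColl (C : Finset ι) : Mat α := ∑ ν ∈ C, J.projBlock ν

/-- The projection `M_C = Λ_C† M Λ_C` of a matrix. -/
def restr (C : Finset ι) (M : Mat α) : Mat α := (J.projColl C)ᴴ * M * J.projColl C

end DualJordanSystem

end RPA

end

/-!
Each projector `Λ_C = ∑_{ν ∈ C} Λ_ν` is the coordinate projector onto `⨁_{ν ∈ C} W_ν` along the
other blocks, since it fixes or kills each basis vector (`projColl_mulVec_of_mem_W`).  In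
particular `Λ_C Λ_{C'} = Λ_{C ∩ C'}`, and `Λ_C` commutes with `N S`, which preserves every block.

The two dualities act on the index set of the blocks: `W (lr ν)` is the LR-dual and `W (ul ν)` the
UL-dual of `W ν`.  The block `lr ν` is the only one not `N`-orthogonal to `ν`
(`eq_lr_of_pairing_ne_zero`); as `N` is Hermitian, `lr` is an involution.  As `x ↦ Σ_x x^*` is an
antilinear involution that preserves the pairing up to sign and conjugation, `ul` is an involution
that commutes with `lr`.  Hence the collective index `[ν]` is the orbit of `ν` under a quotient
of the Klein four-group; the orbits partition the blocks, and each is closed under both dualities.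

Closure under `lr` makes `Λ_[ν]` self-adjoint for the pairing, `Λ_[ν]† N = N Λ_[ν]`
(`conjTranspose_projColl_mul_metricN`), and with the commutation with `N S` also
`Λ_[ν]† S = S Λ_[ν]`.  So `N_[ν] = N Λ_[ν]` and `S_[ν] = S Λ_[ν]`, which gives the block
decomposition.  Closure under `ul` gives `Σ_x Λ_[ν]^* Σ_x = Λ_[ν]`, through which the symmetry
`Σ_x S^* Σ_x = S` passes to `S_[ν]`.
-/

open scoped Matrix

noncomputable section

namespace RPA

variable {α : Type*} [Fintype α] [DecidableEq α]

/-! ### The metric, the stability matrix and the antilinear involution -/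

lemma metricN_mul_self : metricN α * metricN α = 1 := by
  simp [metricN, Matrix.fromBlocks_multiply]

lemma sigmaX_mul_self : sigmaX α * sigmaX α = 1 := by
  simp [sigmaX, Matrix.fromBlocks_multiply]

omit [DecidableEq α] in
lemma conjMat_mul (M M' : Mat α) : conjMat (M * M') = conjMat M * conjMat M' :=
  Matrix.map_mul (f := starRingEnd ℂ)

omit [DecidableEq α] in
lemma star_mulVec_eq_conjMat (M : Mat α) (x : Vec α) : star (M *ᵥ x) = conjMat M *ᵥ star x := by
  ext i
  simp [Matrix.mulVec, dotProduct, conjMat]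

omit [Fintype α] [DecidableEq α] in
lemma conjTranspose_stab {A B : Matrix α α ℂ} (hA : Aᴴ = A) (hB : Bᵀ = B) :
    (stab A B)ᴴ = stab A B := by
  have hA' (i j) : star (A j i) = A i j := congrFun (congrFun hA i) j
  have hB' (i j) : B j i = B i j := congrFun (congrFun hB i) j
  ext (i | i) (j | j)
  · simpa [stab] using hA' i j
  · simp [stab, hB' i j]
  · simp [stab, hB' i j]
  · simpa [stab] using (congrArg star (hA' i j))

lemma sigmaX_mul_conjMat_stab_mul_sigmaX (A B : Matrix α α ℂ) :
    sigmaX α * conjMat (stab A B) * sigmaX α = stab A B := by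
  simp [sigmaX, conjMat, stab, Matrix.fromBlocks_map, Matrix.fromBlocks_multiply, Function.comp_def]

lemma ulDual_inl (x : Vec α) (i : α) : ulDual x (Sum.inl i) = star (x (Sum.inr i)) := by
  simp [ulDual, sigmaX, Matrix.fromBlocks_mulVec]

lemma ulDual_inr (x : Vec α) (i : α) : ulDual x (Sum.inr i) = star (x (Sum.inl i)) := by
  simp [ulDual, sigmaX, Matrix.fromBlocks_mulVec]

lemma ulDual_ulDual (x : Vec α) : ulDual (ulDual x) = x := by
  ext (i | i) <;> simp [ulDual_inl, ulDual_inr]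

lemma ulDual_zero : ulDual (0 : Vec α) = 0 := by
  simp [ulDual]

lemma ulDual_add (x y : Vec α) : ulDual (x + y) = ulDual x + ulDual y := by
  simp [ulDual, Matrix.mulVec_add]

lemma ulDual_smul (a : ℂ) (x : Vec α) : ulDual (a • x) = star a • ulDual x := by
  simp [ulDual, Matrix.mulVec_smul]

lemma ulDual_mem_span_range {κ : Type*} (f : κ → Vec α) {x : Vec α}
    (hx : x ∈ Submodule.span ℂ (Set.range f)) :
    ulDual x ∈ Submodule.span ℂ (Set.range fun k => ulDual (f k)) := by
  induction hx using Submodule.span_induction with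
  | mem x hx =>
    obtain ⟨k, rfl⟩ := hx
    exact Submodule.subset_span ⟨k, rfl⟩
  | zero => simp [ulDual_zero]
  | add x y _ _ hx hy => rw [ulDual_add]; exact add_mem hx hy
  | smul a x _ hx => rw [ulDual_smul]; exact Submodule.smul_mem _ _ hx

/-! ### The pairing -/

lemma pairing_eq_sum (x y : Vec α) : pairing x y =
    ∑ i, star (x (Sum.inl i)) * y (Sum.inl i) - ∑ i, star (x (Sum.inr i)) * y (Sum.inr i) := by
  simp [pairing, metricN, Matrix.fromBlocks_mulVec, Matrix.neg_mulVec, dotProduct, sub_eq_add_neg]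

lemma star_pairing (x y : Vec α) : star (pairing x y) = pairing y x := by
  simp [pairing_eq_sum, mul_comm]

lemma pairing_ulDual (x y : Vec α) : pairing (ulDual x) (ulDual y) = -star (pairing x y) := by
  simp [pairing_eq_sum, ulDual_inl, ulDual_inr]

lemma pairing_zero_right (x : Vec α) : pairing x 0 = 0 := by
  simp [pairing]

lemma pairing_zero_left (x : Vec α) : pairing 0 x = 0 := by
  simp [pairing]

lemma pairing_add_right (x y z : Vec α) : pairing x (y + z) = pairing x y + pairing x z := by
  simp [pairing, Matrix.mulVec_add]

lemma pairing_smul_right (a : ℂ) (x y : Vec α) : pairing x (a • y) = a * pairing x y := by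
  simp [pairing, Matrix.mulVec_smul]

lemma pairing_eq_zero_comm {x y : Vec α} : pairing x y = 0 ↔ pairing y x = 0 := by
  rw [← star_pairing y x, star_eq_zero]

lemma pairing_eq_zero_of_mem_span_right {s : Set (Vec α)} {x y : Vec α}
    (h : ∀ z ∈ s, pairing x z = 0) (hy : y ∈ Submodule.span ℂ s) : pairing x y = 0 := by
  induction hy using Submodule.span_induction with
  | mem z hz => exact h z hz
  | zero => exact pairing_zero_right x
  | add y z _ _ hy hz => rw [pairing_add_right, hy, hz, add_zero]
  | smul a y _ hy => rw [pairing_smul_right, hy, mul_zero]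

lemma pairing_eq_zero_of_mem_span {s t : Set (Vec α)} {x y : Vec α}
    (h : ∀ w ∈ s, ∀ z ∈ t, pairing w z = 0) (hx : x ∈ Submodule.span ℂ s)
    (hy : y ∈ Submodule.span ℂ t) : pairing x y = 0 :=
  pairing_eq_zero_of_mem_span_right (fun z hz => pairing_eq_zero_comm.1 <|
    pairing_eq_zero_of_mem_span_right (fun w hw => pairing_eq_zero_comm.1 (h w hw z hz)) hx) hy

namespace JordanSystem

variable {A B : Matrix α α ℂ} {ι : Type*} (J : JordanSystem A B ι)

lemma ξ_mem_W (ν : ι) (k : Fin (J.d ν)) : J.ξ ν k ∈ J.W ν :=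
  Submodule.subset_span ⟨k, rfl⟩

lemma ξ_ne_zero (ν : ι) (k : Fin (J.d ν)) : J.ξ ν k ≠ 0 :=
  J.indep.ne_zero (⟨ν, k⟩ : (ν : ι) × Fin (J.d ν))

lemma matrix_ext {M M' : Mat α} (h : ∀ ν k, M *ᵥ J.ξ ν k = M' *ᵥ J.ξ ν k) : M = M' := by
  apply Matrix.mulVec_injective
  have : M.mulVecLin = M'.mulVecLin := LinearMap.ext_on_range J.complete fun p => h p.1 p.2
  exact congrArg DFunLike.coe this

lemma eq_zero_of_star_ξ_dotProduct {z : Vec α} (h : ∀ ν k, star (J.ξ ν k) ⬝ᵥ z = 0) : z = 0 := by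
  suffices hz : star z = 0 from star_eq_zero.1 hz
  refine dotProduct_eq_zero _ fun y => ?_
  have hy : y ∈ Submodule.span ℂ (Set.range fun p : (ν : ι) × Fin (J.d ν) => J.ξ p.1 p.2) := by
    rw [J.complete]
    exact Submodule.mem_top
  induction hy using Submodule.span_induction with
  | mem y hy =>
    obtain ⟨p, rfl⟩ := hy
    rw [← star_eq_zero, ← Matrix.star_dotProduct_star, star_star, ← h p.1 p.2]
  | zero => simp
  | add x y _ _ hx hy => rw [dotProduct_add, hx, hy, add_zero]
  | smul a x _ hx => rw [dotProduct_smul, hx, smul_zero]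

lemma metricN_mul_stab_mulVec_mem_W {ν : ι} {x : Vec α} (hx : x ∈ J.W ν) :
    (metricN α * stab A B) *ᵥ x ∈ J.W ν := by
  have hN (y : Vec α) : metricN α *ᵥ (metricN α *ᵥ y) = y := by
    rw [Matrix.mulVec_mulVec, metricN_mul_self, Matrix.one_mulVec]
  suffices h : J.W ν ≤ (J.W ν).comap (metricN α * stab A B).mulVecLin from h hx
  refine Submodule.span_le.2 ?_
  rintro _ ⟨⟨k, hk⟩, rfl⟩
  change (metricN α * stab A B) *ᵥ J.ξ ν ⟨k, hk⟩ ∈ J.W ν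
  rw [← Matrix.mulVec_mulVec]
  cases k with
  | zero =>
    rw [J.eigen, Matrix.mulVec_smul, hN]
    exact Submodule.smul_mem _ _ (J.ξ_mem_W _ _)
  | succ k =>
    rw [J.chain, Matrix.mulVec_add, Matrix.mulVec_smul, Matrix.mulVec_smul, hN, hN]
    exact add_mem (Submodule.smul_mem _ _ (J.ξ_mem_W _ _))
      (Submodule.smul_mem _ _ (J.ξ_mem_W _ _))

end JordanSystem

namespace DualJordanSystem

variable {A B : Matrix α α ℂ} {ι : Type*} (J : DualJordanSystem A B ι)

/-! ### The coordinate projectors -/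

lemma projVec_mulVec (ν : ι) (k : Fin (J.d ν)) (x : Vec α) :
    J.projVec ν k *ᵥ x =
      ((pairing (J.ξbar ν k) (J.ξ ν k))⁻¹ * pairing (J.ξbar ν k) x) • J.ξ ν k := by
  ext i
  simp [projVec, Matrix.smul_mulVec, Matrix.vecMulVec_mulVec, pairing, Matrix.dotProduct_mulVec]
  ring

lemma projBlock_mulVec_mem_W (ν : ι) (x : Vec α) : J.projBlock ν *ᵥ x ∈ J.W ν := by
  rw [projBlock, Matrix.sum_mulVec]
  refine Submodule.sum_mem _ fun k _ => ?_
  rw [projVec_mulVec]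
  exact Submodule.smul_mem _ _ (J.ξ_mem_W _ _)

lemma projBlock_mulVec_ξ_self (ν : ι) (k : Fin (J.d ν)) :
    J.projBlock ν *ᵥ J.ξ ν k = J.ξ ν k := by
  rw [projBlock, Matrix.sum_mulVec, Finset.sum_eq_single k]
  · rw [projVec_mulVec, inv_mul_cancel₀ ((J.dual ⟨ν, k⟩ ⟨ν, k⟩).2 rfl), one_smul]
  · intro j _ hj
    have h : pairing (J.ξbar ν j) (J.ξ ν k) = 0 := by
      by_contra h
      have h' := (J.dual ⟨ν, j⟩ ⟨ν, k⟩).1 h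
      simp only [Sigma.mk.injEq, heq_eq_eq, true_and] at h'
      exact hj h'
    rw [projVec_mulVec, h, mul_zero, zero_smul]
  · simp

lemma pairing_ξbar_ξ_of_ne {ν μ : ι} (h : ν ≠ μ) (k : Fin (J.d ν)) (j : Fin (J.d μ)) :
    pairing (J.ξbar ν k) (J.ξ μ j) = 0 := by
  by_contra h'
  exact h (congrArg Sigma.fst ((J.dual ⟨ν, k⟩ ⟨μ, j⟩).1 h'))

lemma projBlock_mulVec_ξ_of_ne {ν μ : ι} (h : ν ≠ μ) (k : Fin (J.d μ)) :
    J.projBlock ν *ᵥ J.ξ μ k = 0 := by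
  rw [projBlock, Matrix.sum_mulVec]
  refine Finset.sum_eq_zero fun j _ => ?_
  rw [projVec_mulVec, J.pairing_ξbar_ξ_of_ne h, mul_zero, zero_smul]

open Classical in
lemma projColl_mulVec_of_mem_W (C : Finset ι) {μ : ι} {x : Vec α} (hx : x ∈ J.W μ) :
    J.projColl C *ᵥ x = if μ ∈ C then x else 0 := by
  have hξ (k : Fin (J.d μ)) : J.projColl C *ᵥ J.ξ μ k = if μ ∈ C then J.ξ μ k else 0 := by
    rw [projColl, Matrix.sum_mulVec]
    split_ifs with h
    · rw [Finset.sum_eq_single_of_mem μ h fun ν _ hν => J.projBlock_mulVec_ξ_of_ne hν k,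
        projBlock_mulVec_ξ_self]
    · exact Finset.sum_eq_zero fun ν hν =>
        J.projBlock_mulVec_ξ_of_ne (fun e => h (by rwa [← e])) k
  have key : Set.EqOn (J.projColl C).mulVecLin
      (if μ ∈ C then LinearMap.id else 0 : Vec α →ₗ[ℂ] Vec α) (J.W μ) := by
    refine LinearMap.eqOn_span ?_
    rintro _ ⟨k, rfl⟩
    rw [Matrix.mulVecLin_apply, hξ k]
    split_ifs <;> rfl
  have h := key hx
  rw [Matrix.mulVecLin_apply] at h
  rw [h]
  split_ifs <;> rfl

lemma projColl_mulVec_of_mem {C : Finset ι} {μ : ι} (hμ : μ ∈ C) {x : Vec α} (hx : x ∈ J.W μ) :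
    J.projColl C *ᵥ x = x := by
  rw [J.projColl_mulVec_of_mem_W C hx, if_pos hμ]

lemma projColl_mulVec_of_notMem {C : Finset ι} {μ : ι} (hμ : μ ∉ C) {x : Vec α}
    (hx : x ∈ J.W μ) : J.projColl C *ᵥ x = 0 := by
  rw [J.projColl_mulVec_of_mem_W C hx, if_neg hμ]

open Classical in
lemma projColl_mul_projColl (C C' : Finset ι) :
    J.projColl C * J.projColl C' = J.projColl (C ∩ C') := by
  refine J.matrix_ext fun ν k => ?_
  have hξ := J.ξ_mem_W ν k
  rw [← Matrix.mulVec_mulVec, J.projColl_mulVec_of_mem_W C' hξ,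
    J.projColl_mulVec_of_mem_W _ hξ]
  by_cases h' : ν ∈ C'
  · rw [if_pos h', J.projColl_mulVec_of_mem_W _ hξ]
    simp [h']
  · simp [h']

lemma projColl_empty : J.projColl ∅ = 0 := by
  simp [projColl]

/-- Blocks are independent, so two blocks with a common nonzero vector are equal. -/
lemma eq_of_mem_W {ν μ : ι} {x : Vec α} (h0 : x ≠ 0) (hν : x ∈ J.W ν) (hμ : x ∈ J.W μ) :
    ν = μ := by
  by_contra h
  apply h0
  rw [← J.projColl_mulVec_of_mem (Finset.mem_singleton_self ν) hν]
  exact J.projColl_mulVec_of_notMem (mt Finset.mem_singleton.1 (Ne.symm h)) hμ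

lemma W_injective : Function.Injective J.W := fun ν _ h =>
  J.eq_of_mem_W (J.ξ_ne_zero ν ⟨0, J.d_pos ν⟩) (J.ξ_mem_W ν _) (h ▸ J.ξ_mem_W ν _)

lemma projColl_mul_metricN_mul_stab (C : Finset ι) :
    J.projColl C * (metricN α * stab A B) = metricN α * stab A B * J.projColl C := by
  classical
  refine J.matrix_ext fun ν k => ?_
  have hξ := J.ξ_mem_W ν k
  rw [← Matrix.mulVec_mulVec, ← Matrix.mulVec_mulVec (M := metricN α * stab A B),
    J.projColl_mulVec_of_mem_W C (J.metricN_mul_stab_mulVec_mem_W hξ),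
    J.projColl_mulVec_of_mem_W C hξ]
  split_ifs <;> simp

/-! ### The dualities as commuting involutions of the blocks -/

/-- The index of the LR-dual of the block `ν`, unique because `W` is injective. -/
def lr (ν : ι) : ι := (J.lr_closed ν).choose

/-- The index of the UL-dual of the block `ν`, unique because `W` is injective. -/
def ul (ν : ι) : ι := (J.ul_closed ν).choose

lemma Wbar_eq (ν : ι) : J.Wbar ν = J.W (J.lr ν) := (J.lr_closed ν).choose_spec

lemma WUL_eq (ν : ι) : J.WUL ν = J.W (J.ul ν) := (J.ul_closed ν).choose_spec

lemma ξbar_mem_W (ν : ι) (k : Fin (J.d ν)) : J.ξbar ν k ∈ J.W (J.lr ν) := by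
  rw [← Wbar_eq]
  exact Submodule.subset_span ⟨k, rfl⟩

lemma ulDual_mem_W {ν : ι} {x : Vec α} (hx : x ∈ J.W ν) : ulDual x ∈ J.W (J.ul ν) := by
  rw [← WUL_eq]
  exact ulDual_mem_span_range _ hx

lemma pairing_ξbar_ξ_self_ne_zero (ν : ι) (k : Fin (J.d ν)) :
    pairing (J.ξbar ν k) (J.ξ ν k) ≠ 0 :=
  (J.dual ⟨ν, k⟩ ⟨ν, k⟩).2 rfl

lemma eq_of_pairing_lr_ne_zero {ν μ : ι} {x y : Vec α} (hx : x ∈ J.W (J.lr ν))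
    (hy : y ∈ J.W μ) (h : pairing x y ≠ 0) : ν = μ := by
  by_contra hne
  rw [← Wbar_eq] at hx
  refine h (pairing_eq_zero_of_mem_span ?_ hx hy)
  rintro _ ⟨k, rfl⟩ _ ⟨j, rfl⟩
  exact J.pairing_ξbar_ξ_of_ne hne k j

lemma lr_injective : Function.Injective J.lr := fun ν μ h => by
  have hx := J.ξbar_mem_W ν ⟨0, J.d_pos ν⟩
  rw [h] at hx
  exact (J.eq_of_pairing_lr_ne_zero hx (J.ξ_mem_W ν _) (J.pairing_ξbar_ξ_self_ne_zero ν _)).symm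

lemma lr_lr [Finite ι] (ν : ι) : J.lr (J.lr ν) = ν := by
  -- By injectivity on a finite set, `ν` is itself an LR-dual, of the only block it pairs with.
  obtain ⟨μ, rfl⟩ := Finite.surjective_of_injective J.lr_injective ν
  have h := J.pairing_ξbar_ξ_self_ne_zero (J.lr μ) ⟨0, J.d_pos _⟩
  rw [Ne, pairing_eq_zero_comm] at h
  rw [← J.eq_of_pairing_lr_ne_zero (J.ξ_mem_W _ _) (J.ξbar_mem_W _ _) h]

/-- The LR-dual block is the only one that is not `N`-orthogonal to a given block. -/
lemma eq_lr_of_pairing_ne_zero [Finite ι] {ν μ : ι} {x y : Vec α} (hx : x ∈ J.W ν)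
    (hy : y ∈ J.W μ) (h : pairing x y ≠ 0) : μ = J.lr ν := by
  rw [← J.lr_lr ν] at hx
  exact (J.eq_of_pairing_lr_ne_zero hx hy h).symm

lemma ul_ul (ν : ι) : J.ul (J.ul ν) = ν := by
  have hξ := J.ξ_mem_W ν ⟨0, J.d_pos ν⟩
  have h := J.ulDual_mem_W (J.ulDual_mem_W hξ)
  rw [ulDual_ulDual] at h
  exact J.eq_of_mem_W (J.ξ_ne_zero _ _) h hξ

lemma lr_ul [Finite ι] (ν : ι) : J.lr (J.ul ν) = J.ul (J.lr ν) := by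
  have h := J.eq_lr_of_pairing_ne_zero (J.ulDual_mem_W (J.ξbar_mem_W ν ⟨0, J.d_pos ν⟩))
    (J.ulDual_mem_W (J.ξ_mem_W ν ⟨0, J.d_pos ν⟩)) (by
      rw [pairing_ulDual, neg_ne_zero, star_ne_zero]
      exact J.pairing_ξbar_ξ_self_ne_zero ν _)
  rw [h, lr_lr]

lemma WbarUL_eq (ν : ι) : J.WbarUL ν = J.W (J.ul (J.lr ν)) := by
  apply le_antisymm
  · refine Submodule.span_le.2 ?_
    rintro _ ⟨k, rfl⟩
    exact J.ulDual_mem_W (J.ξbar_mem_W ν k)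
  · rw [← WUL_eq]
    refine Submodule.span_le.2 ?_
    rintro _ ⟨k, rfl⟩
    have h := J.ξ_mem_W (J.lr ν) k
    rw [← Wbar_eq] at h
    exact ulDual_mem_span_range _ h

/-! ### The collective indices -/

variable [Fintype ι]

lemma mem_coll {ν μ : ι} :
    μ ∈ J.coll ν ↔ μ = ν ∨ μ = J.lr ν ∨ μ = J.ul ν ∨ μ = J.ul (J.lr ν) := by
  simp [coll, Wbar_eq, WUL_eq, WbarUL_eq, J.W_injective.eq_iff]

lemma self_mem_coll (ν : ι) : ν ∈ J.coll ν := J.mem_coll.2 (Or.inl rfl)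

lemma coll_lr (ν : ι) : J.coll (J.lr ν) = J.coll ν := by
  ext μ
  simp only [mem_coll, lr_lr]
  tauto

lemma coll_ul (ν : ι) : J.coll (J.ul ν) = J.coll ν := by
  ext μ
  simp only [mem_coll, lr_ul, ul_ul]
  tauto

lemma mem_coll_iff_coll_eq {ν μ : ι} : μ ∈ J.coll ν ↔ J.coll μ = J.coll ν := by
  refine ⟨fun h => ?_, fun h => h ▸ J.self_mem_coll μ⟩
  rcases J.mem_coll.1 h with rfl | rfl | rfl | rfl <;> simp only [coll_lr, coll_ul]

lemma lr_mem_coll {ν μ : ι} : J.lr μ ∈ J.coll ν ↔ μ ∈ J.coll ν := by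
  simp only [mem_coll_iff_coll_eq, coll_lr]

lemma ul_mem_coll {ν μ : ι} : J.ul μ ∈ J.coll ν ↔ μ ∈ J.coll ν := by
  simp only [mem_coll_iff_coll_eq, coll_ul]

lemma disjoint_coll {ν ν' : ι} (h : J.coll ν ≠ J.coll ν') : Disjoint (J.coll ν) (J.coll ν') :=
  Finset.disjoint_left.2 fun _ hμ hμ' =>
    h ((J.mem_coll_iff_coll_eq.1 hμ).symm.trans (J.mem_coll_iff_coll_eq.1 hμ'))

lemma mem_colls {C : Finset ι} : C ∈ J.colls ↔ ∃ ν, J.coll ν = C := by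
  simp [colls]

lemma W_le_Wcoll {ν μ : ι} (h : μ ∈ J.coll ν) : J.W μ ≤ J.Wcoll ν := by
  simp only [Wcoll, Wbar_eq, WUL_eq, WbarUL_eq]
  rcases J.mem_coll.1 h with rfl | rfl | rfl | rfl
  · exact le_sup_of_le_left (le_sup_of_le_left le_sup_left)
  · exact le_sup_of_le_left (le_sup_of_le_left le_sup_right)
  · exact le_sup_of_le_left le_sup_right
  · exact le_sup_right

/-! ### The collective projectors -/

open Classical in
lemma projColl_coll_mul (ν ν' : ι) : J.projColl (J.coll ν) * J.projColl (J.coll ν') =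
    if J.coll ν = J.coll ν' then J.projColl (J.coll ν) else 0 := by
  rw [projColl_mul_projColl]
  split_ifs with h
  · rw [← h, Finset.inter_self]
  · rw [Finset.disjoint_iff_inter_eq_empty.1 (J.disjoint_coll h), projColl_empty]

lemma projColl_coll_mul_self (ν : ι) :
    J.projColl (J.coll ν) * J.projColl (J.coll ν) = J.projColl (J.coll ν) := by
  rw [projColl_coll_mul, if_pos rfl]

lemma range_projColl_coll (ν : ι) :
    LinearMap.range (J.projColl (J.coll ν)).mulVecLin = J.Wcoll ν := by
  apply le_antisymm
  · rintro _ ⟨x, rfl⟩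
    rw [Matrix.mulVecLin_apply, projColl, Matrix.sum_mulVec]
    exact Submodule.sum_mem _ fun μ hμ => J.W_le_Wcoll hμ (J.projBlock_mulVec_mem_W μ x)
  · have h (μ : ι) (hμ : μ ∈ J.coll ν) :
        J.W μ ≤ LinearMap.range (J.projColl (J.coll ν)).mulVecLin :=
      fun x hx => ⟨x, J.projColl_mulVec_of_mem hμ hx⟩
    simp only [Wcoll, Wbar_eq, WUL_eq, WbarUL_eq]
    exact sup_le (sup_le (sup_le (h _ (by simp [mem_coll])) (h _ (by simp [mem_coll])))
      (h _ (by simp [mem_coll]))) (h _ (by simp [mem_coll]))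

lemma projColl_mulVec_of_mem_Wcoll {ν : ι} {x : Vec α} (hx : x ∈ J.Wcoll ν) :
    J.projColl (J.coll ν) *ᵥ x = x := by
  rw [← range_projColl_coll] at hx
  obtain ⟨y, rfl⟩ := hx
  rw [Matrix.mulVecLin_apply, Matrix.mulVec_mulVec, projColl_coll_mul_self]

lemma projColl_univ : J.projColl Finset.univ = 1 :=
  J.matrix_ext fun ν k => by
    rw [J.projColl_mulVec_of_mem (Finset.mem_univ ν) (J.ξ_mem_W ν k), Matrix.one_mulVec]

lemma sum_colls_projColl : ∑ C ∈ J.colls, J.projColl C = 1 := by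
  classical
  have hdisj : Set.PairwiseDisjoint (J.colls : Set (Finset ι)) id := by
    intro C hC C' hC' h
    obtain ⟨ν, rfl⟩ := J.mem_colls.1 hC
    obtain ⟨ν', rfl⟩ := J.mem_colls.1 hC'
    exact J.disjoint_coll h
  have hcover : J.colls.biUnion id = Finset.univ := by
    ext ν
    simp only [Finset.mem_biUnion, mem_colls, Finset.mem_univ, iff_true]
    exact ⟨_, ⟨ν, rfl⟩, J.self_mem_coll ν⟩
  rw [← J.projColl_univ, ← hcover]
  simp only [projColl]
  rw [Finset.sum_biUnion hdisj]
  rfl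

/-- The collective projectors are self-adjoint for the pairing: vectors of two blocks that pair
to a nonzero value lie in LR-dual blocks, and these are both in `[ν]` or both outside it. -/
lemma conjTranspose_projColl_mul_metricN (ν : ι) :
    (J.projColl (J.coll ν))ᴴ * metricN α = metricN α * J.projColl (J.coll ν) := by
  classical
  refine J.matrix_ext fun μ k => ?_
  rw [← sub_eq_zero]
  refine J.eq_zero_of_star_ξ_dotProduct fun μ' k' => ?_
  have h1 : star (J.ξ μ' k') ⬝ᵥ (((J.projColl (J.coll ν))ᴴ * metricN α) *ᵥ J.ξ μ k) =
      pairing (J.projColl (J.coll ν) *ᵥ J.ξ μ' k') (J.ξ μ k) := by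
    rw [pairing, Matrix.star_mulVec, ← Matrix.dotProduct_mulVec, Matrix.mulVec_mulVec]
  have h2 : star (J.ξ μ' k') ⬝ᵥ ((metricN α * J.projColl (J.coll ν)) *ᵥ J.ξ μ k) =
      pairing (J.ξ μ' k') (J.projColl (J.coll ν) *ᵥ J.ξ μ k) := by
    rw [pairing, Matrix.mulVec_mulVec]
  rw [dotProduct_sub, h1, h2, sub_eq_zero, J.projColl_mulVec_of_mem_W _ (J.ξ_mem_W μ k),
    J.projColl_mulVec_of_mem_W _ (J.ξ_mem_W μ' k')]
  by_cases h : pairing (J.ξ μ' k') (J.ξ μ k) = 0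
  · split_ifs <;> simp [h, pairing_zero_left, pairing_zero_right]
  · obtain rfl := J.eq_lr_of_pairing_ne_zero (J.ξ_mem_W μ' k') (J.ξ_mem_W μ k) h
    simp only [lr_mem_coll]
    split_ifs <;> simp [pairing_zero_left, pairing_zero_right]

/-- Obtained by writing `S = N (N S)` and moving `Λ_[ν]†` past `N`, where it becomes `Λ_[ν]`, and
then past `N S`. -/
lemma conjTranspose_projColl_mul_stab (ν : ι) :
    (J.projColl (J.coll ν))ᴴ * stab A B = stab A B * J.projColl (J.coll ν) := by
  have hN (M : Mat α) : metricN α * (metricN α * M) = M := by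
    rw [← mul_assoc, metricN_mul_self, one_mul]
  calc (J.projColl (J.coll ν))ᴴ * stab A B
      = (J.projColl (J.coll ν))ᴴ * metricN α * (metricN α * stab A B) := by rw [mul_assoc, hN]
    _ = metricN α * (J.projColl (J.coll ν) * (metricN α * stab A B)) := by
      rw [conjTranspose_projColl_mul_metricN, mul_assoc]
    _ = stab A B * J.projColl (J.coll ν) := by
      rw [projColl_mul_metricN_mul_stab, mul_assoc, hN]

lemma restr_coll_metricN (ν : ι) :
    J.restr (J.coll ν) (metricN α) = metricN α * J.projColl (J.coll ν) := by
  rw [restr, conjTranspose_projColl_mul_metricN, mul_assoc, projColl_coll_mul_self]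

lemma restr_coll_stab (ν : ι) :
    J.restr (J.coll ν) (stab A B) = stab A B * J.projColl (J.coll ν) := by
  rw [restr, conjTranspose_projColl_mul_stab, mul_assoc, projColl_coll_mul_self]

/-- The collective projectors commute with `x ↦ Σ_x x^*`, since this map sends `W μ` to `W (ul μ)`
and `[ν]` is closed under `ul`. -/
lemma sigmaX_mul_conjMat_projColl_mul_sigmaX (ν : ι) :
    sigmaX α * conjMat (J.projColl (J.coll ν)) * sigmaX α = J.projColl (J.coll ν) := by
  classical
  refine J.matrix_ext fun μ k => ?_
  have hξ := J.ξ_mem_W μ k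
  have h : (sigmaX α * conjMat (J.projColl (J.coll ν)) * sigmaX α) *ᵥ J.ξ μ k =
      ulDual (J.projColl (J.coll ν) *ᵥ ulDual (J.ξ μ k)) := by
    have hstar : star (ulDual (J.ξ μ k)) = sigmaX α *ᵥ J.ξ μ k := by
      ext (i | i) <;> simp [ulDual_inl, ulDual_inr, sigmaX, Matrix.fromBlocks_mulVec]
    conv_rhs => rw [ulDual, star_mulVec_eq_conjMat, hstar]
    simp only [Matrix.mulVec_mulVec, mul_assoc]
  rw [h, J.projColl_mulVec_of_mem_W _ (J.ulDual_mem_W hξ), J.projColl_mulVec_of_mem_W _ hξ]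
  simp only [ul_mem_coll]
  split_ifs
  · exact ulDual_ulDual _
  · exact ulDual_zero

lemma sum_colls_restr {M : Mat α}
    (h : ∀ ν, J.restr (J.coll ν) M = M * J.projColl (J.coll ν)) :
    M = ∑ C ∈ J.colls, J.restr C M := by
  have hsum : ∑ C ∈ J.colls, J.restr C M = ∑ C ∈ J.colls, M * J.projColl C := by
    refine Finset.sum_congr rfl fun C hC => ?_
    obtain ⟨ν, rfl⟩ := J.mem_colls.1 hC
    exact h ν
  rw [hsum, ← Finset.mul_sum, sum_colls_projColl, mul_one]

open Classical in
lemma conjTranspose_projColl_mul_mul_projColl {M : Mat α}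
    (h : ∀ ν, (J.projColl (J.coll ν))ᴴ * M = M * J.projColl (J.coll ν)) (ν ν' : ι) :
    (J.projColl (J.coll ν))ᴴ * M * J.projColl (J.coll ν') =
      if J.coll ν = J.coll ν' then J.restr (J.coll ν) M else 0 := by
  split_ifs with hc
  · rw [← hc, restr]
  · rw [h, mul_assoc, projColl_coll_mul, if_neg hc, mul_zero]

lemma stab_mulVec_eq_iff_forall_projColl (ω : ℂ) (x : Vec α) :
    stab A B *ᵥ x = ω • (metricN α *ᵥ x) ↔
      ∀ ν, stab A B *ᵥ (J.projColl (J.coll ν) *ᵥ x) =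
        ω • (metricN α *ᵥ (J.projColl (J.coll ν) *ᵥ x)) := by
  constructor
  · intro h ν
    rw [Matrix.mulVec_mulVec, Matrix.mulVec_mulVec, ← conjTranspose_projColl_mul_stab,
      ← conjTranspose_projColl_mul_metricN, ← Matrix.mulVec_mulVec, h, Matrix.mulVec_smul,
      Matrix.mulVec_mulVec]
  · intro h
    have hx : x = ∑ C ∈ J.colls, J.projColl C *ᵥ x := by
      rw [← Matrix.sum_mulVec, sum_colls_projColl, Matrix.one_mulVec]
    rw [hx, Matrix.mulVec_sum, Matrix.mulVec_sum, Finset.smul_sum]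
    refine Finset.sum_congr rfl fun C hC => ?_
    obtain ⟨ν, rfl⟩ := J.mem_colls.1 hC
    exact h ν

end DualJordanSystem

end RPA

end

open Classical RPA in
theorem mainTheorem5 {α : Type*} [Fintype α] [DecidableEq α] {A B : Matrix α α ℂ}
    (hA : Aᴴ = A) (hB : Bᵀ = B) {ι : Type*} [Fintype ι] (J : DualJordanSystem A B ι) :
    -- block-diagonality of `S` and of `N`
    (∀ ν ν' : ι,
      (J.projColl (J.coll ν))ᴴ * stab A B * J.projColl (J.coll ν') =
          (if J.coll ν = J.coll ν' then J.restr (J.coll ν) (stab A B) else 0) ∧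
      (J.projColl (J.coll ν))ᴴ * metricN α * J.projColl (J.coll ν') =
          (if J.coll ν = J.coll ν' then J.restr (J.coll ν) (metricN α) else 0)) ∧
    -- the `Λ_[ν]` are complementary projectors onto the `W_[ν]`
    ((∀ ν ν' : ι, J.projColl (J.coll ν) * J.projColl (J.coll ν') =
          if J.coll ν = J.coll ν' then J.projColl (J.coll ν) else 0) ∧
      (∀ ν : ι, LinearMap.range (J.projColl (J.coll ν)).mulVecLin = J.Wcoll ν) ∧
      ∑ C ∈ J.colls, J.projColl C = 1) ∧
    -- `S` and `N` are the sums of their projections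
    (stab A B = ∑ C ∈ J.colls, J.restr C (stab A B) ∧
      metricN α = ∑ C ∈ J.colls, J.restr C (metricN α)) ∧
    -- within `W_[ν]` the RPA equation is the one of the projected matrices
    (∀ (ν : ι) (ω : ℂ), ∀ x ∈ J.Wcoll ν,
      stab A B *ᵥ x = ω • (metricN α *ᵥ x) ↔
        J.restr (J.coll ν) (stab A B) *ᵥ x = ω • (J.restr (J.coll ν) (metricN α) *ᵥ x)) ∧
    -- the RPA equation is equivalent to its projected equations
    (∀ (ω : ℂ) (x : Vec α),
      stab A B *ᵥ x = ω • (metricN α *ᵥ x) ↔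
        ∀ ν : ι, J.restr (J.coll ν) (stab A B) *ᵥ (J.projColl (J.coll ν) *ᵥ x) =
          ω • (J.restr (J.coll ν) (metricN α) *ᵥ (J.projColl (J.coll ν) *ᵥ x))) ∧
    -- both symmetries of `S` are inherited
    (∀ ν : ι,
      (J.restr (J.coll ν) (stab A B))ᴴ = J.restr (J.coll ν) (stab A B) ∧
      sigmaX α * conjMat (J.restr (J.coll ν) (stab A B)) * sigmaX α =
        J.restr (J.coll ν) (stab A B)) := by
  have hS := J.restr_coll_stab
  have hN := J.restr_coll_metricN
  refine ⟨fun ν ν' => ⟨?_, ?_⟩, ⟨J.projColl_coll_mul, J.range_projColl_coll,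
    J.sum_colls_projColl⟩, ⟨J.sum_colls_restr hS, J.sum_colls_restr hN⟩, ?_, ?_,
    fun ν => ⟨?_, ?_⟩⟩
  · exact J.conjTranspose_projColl_mul_mul_projColl J.conjTranspose_projColl_mul_stab ν ν'
  · exact J.conjTranspose_projColl_mul_mul_projColl J.conjTranspose_projColl_mul_metricN ν ν'
  · intro ν ω x hx
    rw [hS, hN, ← Matrix.mulVec_mulVec, ← Matrix.mulVec_mulVec, J.projColl_mulVec_of_mem_Wcoll hx]
  · intro ω x
    rw [J.stab_mulVec_eq_iff_forall_projColl]
    refine forall_congr' fun ν => ?_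
    rw [hS, hN, Matrix.mulVec_mulVec (M := stab A B * _), Matrix.mulVec_mulVec (M := metricN α * _),
      mul_assoc, mul_assoc, J.projColl_coll_mul_self, ← Matrix.mulVec_mulVec,
      ← Matrix.mulVec_mulVec]
  · rw [DualJordanSystem.restr, Matrix.conjTranspose_mul, Matrix.conjTranspose_mul,
      Matrix.conjTranspose_conjTranspose, conjTranspose_stab hA hB, mul_assoc]
  · -- Inserting `Σ_x² = 1` splits the conjugated product into two conjugated factors.
    have hσ (M : Mat α) : sigmaX α * (sigmaX α * M) = M := by
      rw [← mul_assoc, sigmaX_mul_self, one_mul]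
    calc _ = sigmaX α * conjMat (stab A B) * sigmaX α *
          (sigmaX α * conjMat (J.projColl (J.coll ν)) * sigmaX α) := by
            rw [hS, conjMat_mul]
            simp only [mul_assoc, hσ]
      _ = _ := by
            rw [sigmaX_mul_conjMat_stab_mul_sigmaX, J.sigmaX_mul_conjMat_projColl_mul_sigmaX, hS]
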